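/- **Setting.** Let $d\ge 1$. A $\mathbb Z^d$-periodic graph $\Gamma$ is a locally finite simple graph whose vertex set is $V=\{v_p+\mathbf n_{\mathfrak a}: p\in I,\ \mathbf n\in\mathbb Z^d\}$ with $I$ finite (all these vertices being distinct) and whose adjacency is invariant under translations in $\mathbb Z^d$. Let $\mathcal A_\Gamma$ be its adjacency operator, $(\mathcal A_\Gamma f)(v)=\sum_{w\sim v}f(w)$, and for $\theta\in\mathbb R^d$ let $H_\Gamma(\theta)$ be its Floquet matrix, $H_\Gamma(\theta)(p,q)=\sum_{\mathbf n:\ v_q+\mathbf n_{\mathfrak a}\sim v_p}e^{2\pi i\,\mathbf n\cdot\theta}$ for $p,q\in I$. The band functions of $\mathcal A_\Gamma$ are the eigenvalues $E_s(\theta)$ of $H_\Gamma(\theta)$, repeated according to multiplicity, as functions of $\theta$. Put $\mathbb L_N^d=\{0,\dots,N-1\}^d$. The *Floquet non-resonance assumption* for $\mathcal A_\Gamma$ is that for all $s,w$ $$\sup_{\mathbf m\in\mathbb L_N^d,\ \mathbf m\ne 0}\frac{\#\{\mathbf r\in\mathbb L_N^d: E_s(\frac{\mathbf r+\mathbf m}N)-E_w(\frac{\mathbf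 r}N)=0\}}{N^d}\longrightarrow 0\qquad(N\to\infty).$$ For an observable $a:V\to\mathbb C$ (only its values at the points $\mathbf k_{\mathfrak a}+v_q$ with $\mathbf k\in\mathbb L_N^d$ matter) put $$\langle a(\cdot+v_q)\rangle=\frac1{N^d}\sum_{\mathbf k\in\mathbb L_N^d}a(\mathbf k_{\mathfrak a}+v_q),\qquad \langle a\rangle_p=\frac1{N^d}\sum_{\mathbf r\in\mathbb L_N^d}\sum_{q}\langle a(\cdot+v_q)\rangle\sum_{E}\Big|P_{E}\Big(\frac{\mathbf r}N\Big)(p,q)\Big|^2,$$ where $E$ runs over the distinct eigenvalues of $H_\Gamma(\mathbf r/N)$ and $P_E(\mathbf r/N)$ is the orthogonal projection onto the corresponding eigenspace. **Proposition 1.1.** Let $\Gamma_0$ be a connected $\mathbb Z^d$-periodic graph with one vertex in its fundamental domain and with band function $E_{\Gamma_0}(\theta)$. Let $G_F$ be a finite simple graph with vertices $v_1,\dots,v_{\nu_F}$, adjacency matrix $A_{G_F}$, an orthonormal basis $(w_j)$ of eigenvectors and corresponding eigenvalues $(\mu_j)$. Let $\Gamma_1=\Gamma_0\mathop\square G_F$,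 $\Gamma_2=\Gamma_0\times G_F$ and $\Gamma_3=\Gamma_0\boxtimes G_F$ be the Cartesian, tensor and strong products, viewed as $\mathbb Z^d$-periodic graphs with fundamental domain $\{v_1,\dots,v_{\nu_F}\}$. Then: 1. The band functions of $\mathcal A_{\Gamma_1}$ are $E_j(\theta)=E_{\Gamma_0}(\theta)+\mu_j$. 2. The band functions of $\mathcal A_{\Gamma_2}$ are $E_j(\theta)=\mu_jE_{\Gamma_0}(\theta)$. 3. The band functions of $\mathcal A_{\Gamma_3}$ are $E_j(\theta)=(1+\mu_j)E_{\Gamma_0}(\theta)+\mu_j$. 4. The Floquet non-resonance assumption holds for $\mathcal A_{\Gamma_1}$. It does not necessarily hold for $\mathcal A_{\Gamma_2}$ or $\mathcal A_{\Gamma_3}$: for every $\Gamma_0$ as above there is a finite connected graph $G$ with at least two vertices such that it fails for $\Gamma_0\times G$, and there is one such that it fails for $\Gamma_0\boxtimes G$. 5. Let $P_{\mu}(v_p,v_q)=\sum_{j:\mu_j=\mu}w_j(v_p)\overline{w_j(v_q)}$. This is the kernel of the orthogonal projection onto $\ker(A_{G_F}-\mu)$. The formula $$\langle a\rangle_p=\sum_{q=1}^{\nu_F}\langle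 a(\cdot+v_q)\rangle\sum_{s}|P_{\mu_s}(v_p,v_q)|^2,$$ where $\mu_s$ runs over the distinct eigenvalues of $A_{G_F}$, holds for each $p$ in the following sense. For $\Gamma_1$ it holds for every $N\ge1$ and every observable $a$. For $\Gamma_2$ it holds for every observable and every $N\ge 1$ such that $E_{\Gamma_0}(\mathbf r/N)\ne0$ for all $\mathbf r\in\mathbb L_N^d$, and for $\Gamma_3$ for every observable and every $N\ge 1$ such that $E_{\Gamma_0}(\mathbf r/N)\neq-1$ for all $\mathbf r\in\mathbb L_N^d$. For $\Gamma_2$ and $\Gamma_3$ it moreover holds in the limit of large $N$ without this restriction: the difference of the two sides tends to $0$ as $N\to\infty$, for every sequence of observables $a=a_N$ whose averages $\langle a_N(\cdot+v_q)\rangle$ are bounded uniformly in $N$ and $q$ (for example $|a_N|\le C$). -/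

import Mathlib

open Filter Topology Finset

/-- A (locally finite, not necessarily connected) `ℤ^d`-periodic graph on the vertex set `V`, with
fundamental domain `V_f = {v_i : i ∈ ι}`.  The bijection `coord` expresses
`V = V_f + ℤ_𝔞^d`: the vertex `coord (i, n)` is `v_i + n_𝔞`. -/
structure PeriodicGraph (d : ℕ) (ι V : Type*) where
  graph : SimpleGraph V
  coord : ι × (Fin d → ℤ) ≃ V
  periodic : ∀ (i j : ι) (n m k : Fin d → ℤ),
    graph.Adj (coord (i, n + k)) (coord (j, m + k)) ↔ graph.Adj (coord (i, n)) (coord (j, m))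
  locallyFinite : ∀ v : V, (graph.neighborSet v).Finite

/-- The tensor product: `(x, p) ∼ (y, q)` iff `x ∼ y` and `p ∼ q`. -/
def tensorGraph {V F : Type*} (G : SimpleGraph V) (H : SimpleGraph F) : SimpleGraph (V × F) where
  Adj x y := G.Adj x.1 y.1 ∧ H.Adj x.2 y.2
  symm := ⟨fun _ _ h => ⟨h.1.symm, h.2.symm⟩⟩
  loopless := ⟨fun _ h => G.irrefl h.1⟩

/-- The strong product: distinct vertices are adjacent iff they are adjacent in the Cartesian
product or in the tensor product. -/
def strongGraph {V F : Type*} (G : SimpleGraph V) (H : SimpleGraph F) : SimpleGraph (V × F) :=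
  G.boxProd H ⊔ tensorGraph G H

namespace PeriodicGraph

/-- If `Γ₀` has the single vertex `v₀` in its fundamental domain, then each vertex of
`V × F` is uniquely of the form `(v₀ + n_𝔞, f)`, which is written `f + n_𝔞`: the set `F` is
the fundamental domain of the products of `Γ₀` with a graph on `F`. -/
def prodCoord {d : ℕ} {V : Type*} (Γ₀ : PeriodicGraph d Unit V) (F : Type*) :
    F × (Fin d → ℤ) ≃ V × F where
  toFun x := (Γ₀.coord ((), x.2), x.1)
  invFun y := (y.2, (Γ₀.coord.symm y.1).2)
  left_inv x := by simp
  right_inv y := by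
    have h : (((), (Γ₀.coord.symm y.1).2) : Unit × (Fin d → ℤ)) = Γ₀.coord.symm y.1 := rfl
    simp [h]

theorem strong_neighborSet_finite {d : ℕ} {V F : Type*} [Finite F]
    (Γ₀ : PeriodicGraph d Unit V) (G : SimpleGraph F) (v : V × F) :
    ((strongGraph Γ₀.graph G).neighborSet v).Finite := by
  refine (((Γ₀.locallyFinite v.1).insert v.1).prod (Set.finite_univ (α := F))).subset ?_
  intro y hy
  refine ⟨?_, Set.mem_univ _⟩
  rcases hy with (h | h) | h
  · exact Or.inr h.1
  · exact Or.inl h.2.symm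
  · exact Or.inr h.1

/-- The Cartesian product `Γ₀ □ G_F`, with fundamental domain `G_F`. -/
def cartesian {d : ℕ} {V F : Type*} [Finite F] (Γ₀ : PeriodicGraph d Unit V)
    (G : SimpleGraph F) : PeriodicGraph d F (V × F) where
  graph := Γ₀.graph.boxProd G
  coord := Γ₀.prodCoord F
  periodic i j n m k := by
    simp [prodCoord, SimpleGraph.boxProd_adj, Γ₀.periodic () () n m k]
  locallyFinite v := (Γ₀.strong_neighborSet_finite G v).subset fun _ h => Or.inl h

/-- The tensor product `Γ₀ × G_F`, with fundamental domain `G_F`. -/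
def tensor {d : ℕ} {V F : Type*} [Finite F] (Γ₀ : PeriodicGraph d Unit V)
    (G : SimpleGraph F) : PeriodicGraph d F (V × F) where
  graph := tensorGraph Γ₀.graph G
  coord := Γ₀.prodCoord F
  periodic i j n m k := by
    simp [prodCoord, tensorGraph, Γ₀.periodic () () n m k]
  locallyFinite v := (Γ₀.strong_neighborSet_finite G v).subset fun _ h => Or.inr h

/-- The strong product `Γ₀ ⊠ G_F`, with fundamental domain `G_F`. -/
def strong {d : ℕ} {V F : Type*} [Finite F] (Γ₀ : PeriodicGraph d Unit V)
    (G : SimpleGraph F) : PeriodicGraph d F (V × F) where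
  graph := strongGraph Γ₀.graph G
  coord := Γ₀.prodCoord F
  periodic i j n m k := by
    simp [prodCoord, strongGraph, tensorGraph, SimpleGraph.boxProd_adj, Γ₀.periodic () () n m k]
  locallyFinite v := Γ₀.strong_neighborSet_finite G v

/-- The adjacency operator `(𝒜 f)(v) = ∑_{w ∼ v} f w`. -/
noncomputable def adjOp {d : ℕ} {ι V : Type*} (Γ : PeriodicGraph d ι V) (f : V → ℂ) (v : V) : ℂ :=
  ∑ w ∈ (Γ.locallyFinite v).toFinset, f w

/-- The Bloch wave `v_i + n_𝔞 ↦ e^{2πi n·θ} u_i` with quasimomentum `θ` and amplitude `u`. -/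
noncomputable def blochWave {d : ℕ} {ι V : Type*} (Γ : PeriodicGraph d ι V) (θ : Fin d → ℝ)
    (u : ι → ℂ) (v : V) : ℂ :=
  Complex.exp (2 * Real.pi * Complex.I * ∑ i, ((Γ.coord.symm v).2 i : ℂ) * (θ i : ℂ)) *
    u (Γ.coord.symm v).1

/-- The Floquet matrix `H(θ)` of the adjacency operator: the action of `𝒜` on the Bloch waves with
quasimomentum `θ`, that is `H(θ)(p, q) = ∑_{n : v_q + n_𝔞 ∼ v_p} e^{2πi n·θ}`. -/
noncomputable def floquetMatrix {d : ℕ} {ι V : Type*} [DecidableEq ι] (Γ : PeriodicGraph d ι V)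
    (θ : Fin d → ℝ) : Matrix ι ι ℂ :=
  Matrix.of fun p q => Γ.adjOp (Γ.blochWave θ (Pi.single q 1)) (Γ.coord (p, 0))

/-- `(E_j)` are the band functions of `𝒜_Γ`: for each `θ ∈ ℝ^d` the `E_j(θ)` are the eigenvalues of
`H(θ)`, repeated according to multiplicity. -/
def IsBandFamily {d : ℕ} {ι V J : Type*} [Fintype ι] [DecidableEq ι] [Fintype J]
    (Γ : PeriodicGraph d ι V) (E : J → (Fin d → ℝ) → ℝ) : Prop :=
  ∀ θ, (Γ.floquetMatrix θ).charpoly.roots = Finset.univ.val.map fun j => (E j θ : ℂ)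

end PeriodicGraph

/-- The box `𝕃_N^d = {0, …, N - 1}^d`. -/
noncomputable def latticeBox (d N : ℕ) : Finset (Fin d → ℤ) :=
  Fintype.piFinset fun _ => Finset.Ico 0 (N : ℤ)

/-- The point `r / N` of the torus. -/
noncomputable def gridPoint {d : ℕ} (N : ℕ) (r : Fin d → ℤ) : Fin d → ℝ :=
  fun i => (r i : ℝ) / (N : ℝ)

namespace PeriodicGraph

/-- The Floquet non-resonance assumption: for all `s, w`,
`sup_{0 ≠ m ∈ 𝕃_N^d} N^{-d} #{r ∈ 𝕃_N^d : E_s((r + m)/N) - E_w(r/N) = 0} → 0`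
as `N → ∞`.  The band functions are determined up to their labelling at each `θ`; the
assumption is imposed for each labelling (whether it holds does not depend on the labelling). -/
def FloquetAssumption {d : ℕ} {ι V : Type*} [Fintype ι] [DecidableEq ι]
    (Γ : PeriodicGraph d ι V) : Prop :=
  ∀ E : ι → (Fin d → ℝ) → ℝ, Γ.IsBandFamily E → ∀ s w : ι,
    Tendsto (fun N : ℕ => ⨆ m : {m : Fin d → ℤ // m ∈ latticeBox d N ∧ m ≠ 0},
      (#{r ∈ latticeBox d N | E s (gridPoint N (r + m.1)) - E w (gridPoint N r) = 0} : ℝ) /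
        (N : ℝ) ^ d) atTop (𝓝 0)

end PeriodicGraph

/-- The entry `P(p, q)` of the matrix of the orthogonal projection `P` onto `ker (M - z)`. -/
noncomputable def eigenprojKernel {ι : Type*} [Fintype ι] [DecidableEq ι] (M : Matrix ι ι ℂ)
    (z : ℂ) (p q : ι) : ℂ :=
  (Module.End.eigenspace (Matrix.toEuclideanLin M) z).starProjection (EuclideanSpace.single q 1) p

/-- The sum `∑ |P_z(p, q)|²` over the distinct eigenvalues `z` of `M`. -/
noncomputable def eigenprojWeight {ι : Type*} [Fintype ι] [DecidableEq ι] (M : Matrix ι ι ℂ)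
    (p q : ι) : ℝ :=
  ∑ z ∈ M.charpoly.roots.toFinset, ‖eigenprojKernel M z p q‖ ^ 2

namespace PeriodicGraph

/-- The average `⟨a_q⟩ = ⟨a(· + v_q)⟩ = N^{-d} ∑_{k ∈ 𝕃_N^d} a(k_𝔞 + v_q)` of the observable `a`
over the layer of `v_q` in `Γ_N`.  Only the values of `a` on `Γ_N` enter. -/
noncomputable def layerAverage {d : ℕ} {ι V : Type*} (Γ : PeriodicGraph d ι V) (N : ℕ)
    (a : V → ℂ) (q : ι) : ℂ :=
  1 / (N : ℂ) ^ d * ∑ k ∈ latticeBox d N, a (Γ.coord (q, k))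

/-- The limiting average
`⟨a⟩_p = N^{-d} ∑_{r ∈ 𝕃_N^d} ∑_q ⟨a_q⟩ ∑_s |P_{E_s}(r/N)(p, q)|²`,
where `s` runs over the distinct eigenvalues `E_s` of `H(r/N)`. -/
noncomputable def limitAverage {d : ℕ} {ι V : Type*} [Fintype ι] [DecidableEq ι]
    (Γ : PeriodicGraph d ι V) (N : ℕ) (a : V → ℂ) (p : ι) : ℂ :=
  1 / (N : ℂ) ^ d * ∑ r ∈ latticeBox d N, ∑ q,
    Γ.layerAverage N a q * (eigenprojWeight (Γ.floquetMatrix (gridPoint N r)) p q : ℂ)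

end PeriodicGraph

/-- `P_z(p, q) = ∑_{j : μ_j = z} w_j(p) conj (w_j(q))`. -/
noncomputable def basisKernel {F J : Type*} [Fintype F] [Fintype J]
    (w : OrthonormalBasis J ℂ (EuclideanSpace ℂ F)) (μ : J → ℝ) (z : ℝ) (p q : F) : ℂ :=
  ∑ j with μ j = z, w j p * (starRingEnd ℂ) (w j q)

namespace PeriodicGraph

/-- The right-hand side `∑_q ⟨a(· + v_q)⟩ ∑_s |P_{μ_s}(v_p, v_q)|²`, where `s` runs over the
distinct values `μ_s`. -/
noncomputable def finiteAverage {d : ℕ} {V F J : Type*} [Fintype F] [Fintype J]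
    (Γ : PeriodicGraph d F V) (w : OrthonormalBasis J ℂ (EuclideanSpace ℂ F)) (μ : J → ℝ)
    (N : ℕ) (a : V → ℂ) (p : F) : ℂ :=
  ∑ q, Γ.layerAverage N a q *
    ((∑ z ∈ Finset.univ.image μ, ‖basisKernel w μ z p q‖ ^ 2 : ℝ) : ℂ)

/-- `⟨a⟩_p = ∑_q ⟨a(· + v_q)⟩ ∑_s |P_{μ_s}(v_p, v_q)|²` up to an error that tends to `0` as
`N → ∞`, for all sequences of observables `a_N` on `Γ_N` with bounded layer averages (for instance
`|a_N| ≤ C`). -/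
def AsymptoticAverageFormula {d : ℕ} {V F J : Type*} [Fintype F] [DecidableEq F] [Fintype J]
    (Γ : PeriodicGraph d F V) (w : OrthonormalBasis J ℂ (EuclideanSpace ℂ F)) (μ : J → ℝ) :
    Prop :=
  ∀ (a : ℕ → V → ℂ) (C : ℝ), (∀ N q, ‖Γ.layerAverage N (a N) q‖ ≤ C) → ∀ p : F,
    Tendsto (fun N : ℕ => Γ.limitAverage N (a N) p - Γ.finiteAverage w μ N (a N) p) atTop (𝓝 0)

end PeriodicGraph

/-!
Since the fundamental domain of `Γ₀` has one vertex, its band function is the trigonometric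
polynomial `E₀(θ) = ∑ e^{2πi n·θ}` over the finite set of hops `n`, the `n` with
`v₀ + n_𝔞 ∼ v₀` (`band_eq_sum_hops`).  The Floquet matrices of the three products are affine
functions `α(θ) + β(θ) A` of the adjacency matrix `A` of the finite graph, with
`(α, β) = (E₀, 1)`, `(0, E₀)`, `(E₀, 1 + E₀)` (`floquetMatrix_cartesian`, `floquetMatrix_tensor`,
`floquetMatrix_strong`).  An eigenbasis of `A` diagonalizes all of them at once, which gives the
bands `α + β μ_j`.

Where `β(θ) ≠ 0`, the matrix `α(θ) + β(θ) A` has the eigenprojections of `A`, so these quasimomenta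
contribute to `⟨a⟩_p` exactly what the formula predicts.  Where `β(θ) = 0`, the matrix is the same
scalar matrix each time.  The error in the formula is therefore a fixed linear combination of the
layer averages times the proportion of grid points with `β = 0`
(`limitAverage_sub_finiteAverage_of_affine`).

Both the smallness of this proportion and the Floquet assumption for the Cartesian product come
from one counting lemma, `exists_card_trigPoly_zeros_le`: a nonzero trigonometric polynomial with
frequencies in a fixed finite set vanishes on a proportion `O(1/N)` of the grid, uniformly in its
coefficients, by the Schwartz-Zippel lemma.  It applies to `E₀ - b` because there is a hop, and to
`E₀(θ + m/N) - E₀(θ) - b`, whose coefficients are `e^{2πi n·m/N} - 1` at the hops `n`, because the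
hops generate `ℤ^d` when `Γ₀` is connected (`torusChar_eq_one_of_hops`), so that some such
coefficient is nonzero for `m ≠ 0`.

The assumption fails as soon as some band `α + β μ_j` is constant
(`not_floquetAssumption_of_flat_band`): this happens for `μ_j = 0` in the tensor product and for
`μ_j = -1` in the strong product.
-/

/-! ### Matrices with an orthonormal eigenbasis -/

/-- Only the eigenbasis enters: `M` need not be Hermitian a priori. -/
theorem repr_toEuclideanLin_of_eigenbasis {F J : Type*} [Fintype F] [DecidableEq F] [Fintype J]
    (w : OrthonormalBasis J ℂ (EuclideanSpace ℂ F)) {M : Matrix F F ℂ} {ev : J → ℂ}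
    (hw : ∀ j, Matrix.toEuclideanLin M (w j) = ev j • w j) (v : EuclideanSpace ℂ F) (j : J) :
    w.repr (Matrix.toEuclideanLin M v) j = ev j * w.repr v j := by
  classical
  conv_lhs => rw [← w.sum_repr v, map_sum, map_sum]
  simp only [map_smul, hw, WithLp.ofLp_sum, Finset.sum_apply, PiLp.smul_apply, w.repr_self,
    PiLp.single_apply, smul_eq_mul, mul_ite, mul_one, mul_zero, Finset.sum_ite_eq,
    Finset.mem_univ, if_true]
  ring

theorem exists_eigenbasis_index {F J : Type*} [Fintype F] [DecidableEq F] [Fintype J]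
    (w : OrthonormalBasis J ℂ (EuclideanSpace ℂ F)) {M : Matrix F F ℂ} {ev : J → ℂ}
    (hw : ∀ j, Matrix.toEuclideanLin M (w j) = ev j • w j) {v : EuclideanSpace ℂ F} (hv : v ≠ 0)
    {z : ℂ} (h : Matrix.toEuclideanLin M v = z • v) : ∃ j, ev j = z := by
  by_contra! hne
  apply hv
  apply w.repr.injective
  ext j
  have h1 := repr_toEuclideanLin_of_eigenbasis w hw v j
  rw [h] at h1
  have h2 : (z - ev j) * w.repr v j = 0 := by
    simp only [map_smul, PiLp.smul_apply, smul_eq_mul] at h1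
    rw [sub_mul, h1, sub_self]
  simpa [sub_eq_zero, (hne j).symm] using h2

theorem charpoly_roots_of_eigenbasis {F J : Type*} [Fintype F] [DecidableEq F] [Fintype J]
    (w : OrthonormalBasis J ℂ (EuclideanSpace ℂ F)) {M : Matrix F F ℂ} {ev : J → ℂ}
    (hw : ∀ j, Matrix.toEuclideanLin M (w j) = ev j • w j) :
    M.charpoly.roots = Finset.univ.val.map ev := by
  classical
  have h1 : LinearMap.toMatrix w.toBasis w.toBasis (Matrix.toEuclideanLin M)
      = Matrix.diagonal ev := by
    ext i j
    rw [LinearMap.toMatrix_apply, OrthonormalBasis.coe_toBasis_repr_apply,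
      OrthonormalBasis.coe_toBasis, hw j, map_smul, w.repr_self, PiLp.smul_apply,
      PiLp.single_apply, smul_eq_mul, Matrix.diagonal_apply]
    split_ifs with h
    · rw [h, mul_one]
    · rw [mul_zero]
  have h2 : M.charpoly = (Matrix.diagonal ev).charpoly := by
    rw [← h1, LinearMap.charpoly_toMatrix]
    change _ = (Matrix.toLpLin 2 2 M).charpoly
    rw [Matrix.toLpLin_eq_toLin, Matrix.charpoly_toLin]
  rw [h2, Matrix.charpoly_diagonal]
  exact Polynomial.roots_multiset_prod_X_sub_C (Finset.univ.val.map ev) ▸ by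
    rw [Multiset.map_map]; rfl

theorem eigenprojKernel_of_eigenbasis {F J : Type*} [Fintype F] [DecidableEq F] [Fintype J]
    (w : OrthonormalBasis J ℂ (EuclideanSpace ℂ F)) {M : Matrix F F ℂ} {ev : J → ℂ}
    (hw : ∀ j, Matrix.toEuclideanLin M (w j) = ev j • w j) (z : ℂ) (p q : F) :
    eigenprojKernel M z p q = ∑ j with ev j = z, w j p * (starRingEnd ℂ) (w j q) := by
  classical
  set K := Module.End.eigenspace (Matrix.toEuclideanLin M) z
  set x : EuclideanSpace ℂ F := EuclideanSpace.single q 1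
  have hproj : K.starProjection x = ∑ j with ev j = z, w.repr x j • w j := by
    refine Submodule.eq_starProjection_of_mem_of_inner_eq_zero ?_ fun v hv => ?_
    · refine Submodule.sum_mem _ fun j hj => Submodule.smul_mem _ _ ?_
      rw [Module.End.mem_eigenspace_iff, hw j, (Finset.mem_filter.1 hj).2]
    · rw [Module.End.mem_eigenspace_iff] at hv
      have hy : x - ∑ j with ev j = z, w.repr x j • w j
          = ∑ j with ¬ ev j = z, w.repr x j • w j := by
        rw [sub_eq_iff_eq_add', Finset.sum_filter_add_sum_filter_not, w.sum_repr]
      rw [hy, sum_inner]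
      refine Finset.sum_eq_zero fun j hj => ?_
      have h1 := repr_toEuclideanLin_of_eigenbasis w hw v j
      rw [hv, map_smul, PiLp.smul_apply, smul_eq_mul] at h1
      have h2 : (z - ev j) * w.repr v j = 0 := by rw [sub_mul, h1, sub_self]
      have h3 : w.repr v j = 0 := by
        rcases mul_eq_zero.1 h2 with h | h
        · exact absurd (sub_eq_zero.1 h).symm (Finset.mem_filter.1 hj).2
        · exact h
      rw [inner_smul_left, ← w.repr_apply_apply, h3, mul_zero]
  unfold eigenprojKernel
  rw [hproj]
  simp only [WithLp.ofLp_sum, Finset.sum_apply, PiLp.smul_apply, smul_eq_mul, x,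
    w.repr_apply_apply, EuclideanSpace.inner_single_right, one_mul]
  exact Finset.sum_congr rfl fun j _ => mul_comm _ _

/-- The weight of a matrix that is a function of another one: only the level sets of the
eigenvalues matter, so the weights agree as long as the function separates the eigenvalues. -/
theorem eigenprojWeight_of_eigenbasis {F J : Type*} [Fintype F] [DecidableEq F] [Fintype J]
    (w : OrthonormalBasis J ℂ (EuclideanSpace ℂ F)) {M : Matrix F F ℂ} (μ : J → ℝ) {g : ℝ → ℂ}
    (hg : Function.Injective g)
    (hw : ∀ j, Matrix.toEuclideanLin M (w j) = g (μ j) • w j) (p q : F) :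
    eigenprojWeight M p q = ∑ z ∈ Finset.univ.image μ, ‖basisKernel w μ z p q‖ ^ 2 := by
  classical
  have h : M.charpoly.roots.toFinset = (Finset.univ.image μ).image g := by
    rw [charpoly_roots_of_eigenbasis w hw]
    ext z
    simp
  unfold eigenprojWeight
  rw [h, Finset.sum_image fun a _ b _ hab => hg hab]
  refine Finset.sum_congr rfl fun z _ => ?_
  rw [eigenprojKernel_of_eigenbasis w hw, basisKernel]
  simp only [hg.eq_iff]

theorem toEuclideanLin_affine_apply {F : Type*} [Fintype F] [DecidableEq F] {A : Matrix F F ℂ}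
    {x : EuclideanSpace ℂ F} {m : ℂ} (h : Matrix.toEuclideanLin A x = m • x) (α β : ℂ) :
    Matrix.toEuclideanLin (α • (1 : Matrix F F ℂ) + β • A) x = (α + β * m) • x := by
  rw [map_add, map_smul, map_smul, LinearMap.add_apply, LinearMap.smul_apply,
    LinearMap.smul_apply, h, add_smul, mul_smul]
  congr 2
  ext i
  simp

/-! ### Zeros of trigonometric polynomials on the grid -/

/-- The character `θ ↦ e^{2πi n·θ}`. -/
noncomputable def torusChar {d : ℕ} (n : Fin d → ℤ) (θ : Fin d → ℝ) : ℂ :=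
  Complex.exp (2 * Real.pi * Complex.I * ∑ i, (n i : ℂ) * (θ i : ℂ))

theorem torusChar_zero_left {d : ℕ} (θ : Fin d → ℝ) : torusChar 0 θ = 1 := by
  simp [torusChar]

theorem torusChar_add_left {d : ℕ} (n m : Fin d → ℤ) (θ : Fin d → ℝ) :
    torusChar (n + m) θ = torusChar n θ * torusChar m θ := by
  simp only [torusChar, ← Complex.exp_add, ← mul_add, ← Finset.sum_add_distrib]
  simp [add_mul]

theorem torusChar_add_right {d : ℕ} (n : Fin d → ℤ) (θ η : Fin d → ℝ) :
    torusChar n (θ + η) = torusChar n θ * torusChar n η := by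
  simp only [torusChar, ← Complex.exp_add, ← mul_add, ← Finset.sum_add_distrib]
  simp [mul_add]

theorem gridPoint_add {d : ℕ} (N : ℕ) (r m : Fin d → ℤ) :
    gridPoint N (r + m) = gridPoint N r + gridPoint N m := by
  funext i
  simp [gridPoint, add_div]

theorem torusChar_gridPoint {d : ℕ} (N : ℕ) (n r : Fin d → ℤ) :
    torusChar n (gridPoint N r)
      = ∏ i, (Complex.exp (2 * Real.pi * Complex.I / N) ^ (r i)) ^ (n i) := by
  simp only [torusChar, Finset.mul_sum, Complex.exp_sum, ← Complex.exp_int_mul]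
  refine Finset.prod_congr rfl fun i _ => ?_
  congr 1
  simp only [gridPoint]
  push_cast
  ring

theorem card_latticeBox (d N : ℕ) : #(latticeBox d N) = N ^ d := by
  simp [latticeBox]

theorem card_filter_latticeBox_div_le_one {d N : ℕ} (P : (Fin d → ℤ) → Prop) [DecidablePred P] :
    (#{r ∈ latticeBox d N | P r} : ℝ) / (N : ℝ) ^ d ≤ 1 := by
  refine div_le_one_of_le₀ ?_ (by positivity)
  exact_mod_cast (Finset.card_filter_le _ _).trans (card_latticeBox d N).le

theorem torusChar_single_gridPoint_eq_one {d N : ℕ} (hN : 0 < N) {m : Fin d → ℤ}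
    (hm : m ∈ latticeBox d N) {i : Fin d}
    (h : torusChar (Pi.single i 1) (gridPoint N m) = 1) : m i = 0 := by
  rw [torusChar_gridPoint, Finset.prod_eq_single i (fun j _ hj => by simp [hj]) (by simp)] at h
  simp only [Pi.single_eq_same, zpow_one] at h
  have hdvd := ((Complex.isPrimitiveRoot_exp N hN.ne').zpow_eq_one_iff_dvd _).1 h
  have hmi := Finset.mem_Ico.1 (Fintype.mem_piFinset.1 hm i)
  exact Int.eq_zero_of_dvd_of_nonneg_of_lt hmi.1 hmi.2 hdvd

/-- A trigonometric polynomial with frequencies in a fixed finite set that does not vanish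
identically has few zeros on the grid: after multiplication by a monomial it becomes a polynomial
of bounded degree, evaluated at tuples of `N`-th roots of unity, so the Schwartz-Zippel lemma
applies.  The bound is uniform in the coefficients. -/
theorem exists_card_trigPoly_zeros_le {d : ℕ} (T : Finset (Fin d → ℤ)) :
    ∃ D : ℝ, 0 ≤ D ∧ ∀ N : ℕ, 0 < N → ∀ c : (Fin d → ℤ) → ℂ, (∃ n ∈ T, c n ≠ 0) →
      (#{r ∈ latticeBox d N | ∑ n ∈ T, c n * torusChar n (gridPoint N r) = 0} : ℝ) / (N : ℝ) ^ d
        ≤ D / N := by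
  classical
  -- `R` bounds all the frequencies, so that `n + R` has nonnegative entries, at most `2 * R`.
  obtain ⟨R, hR⟩ : ∃ R : ℕ, ∀ n ∈ T, ∀ i, (n i).natAbs ≤ R :=
    ⟨T.sup fun n => Finset.univ.sup fun i => (n i).natAbs, fun n hn i =>
      (Finset.le_sup (f := fun i => (n i).natAbs) (Finset.mem_univ i)).trans
        (Finset.le_sup (f := fun n => Finset.univ.sup fun i => (n i).natAbs) hn)⟩
  let e : (Fin d → ℤ) → (Fin d →₀ ℕ) := fun n => Finsupp.equivFunOnFinite.symm
    fun i => (n i + R).toNat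
  have he : ∀ n i, e n i = (n i + R).toNat := fun n i => rfl
  have hcast : ∀ n ∈ T, ∀ i, ((e n i : ℕ) : ℤ) = n i + R := fun n hn i => by
    have := hR n hn i
    rw [he]; omega
  have hinj : Set.InjOn e T := fun n hn m hm h => by
    funext i
    have h1 := hcast n hn i
    have h2 := hcast m hm i
    rw [h] at h1
    omega
  refine ⟨2 * R * d, by positivity, fun N hN c hc => ?_⟩
  set ζ := Complex.exp (2 * Real.pi * Complex.I / N) with hζdef
  have hζ : IsPrimitiveRoot ζ N := Complex.isPrimitiveRoot_exp N hN.ne'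
  have hζ0 : ζ ≠ 0 := Complex.exp_ne_zero _
  let P : MvPolynomial (Fin d) ℂ := ∑ n ∈ T, MvPolynomial.monomial (e n) (c n)
  have hP : P ≠ 0 := by
    obtain ⟨n, hn, hcn⟩ := hc
    intro h
    apply hcn
    have h1 : P.coeff (e n) = c n := by
      simp only [P, MvPolynomial.coeff_sum, MvPolynomial.coeff_monomial]
      rw [Finset.sum_eq_single n (fun m hm hmn => if_neg fun h => hmn (hinj hm hn h))
        (fun h => absurd hn h), if_pos rfl]
    rw [← h1, h, MvPolynomial.coeff_zero]
  have hdeg : ∀ i, P.degreeOf i ≤ 2 * R := fun i => by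
    refine (MvPolynomial.degreeOf_sum_le i T _).trans (Finset.sup_le fun n hn => ?_)
    rcases eq_or_ne (c n) 0 with h0 | h0
    · simp [h0]
    rw [MvPolynomial.degreeOf_monomial_eq _ _ h0]
    have h1 := hcast n hn i
    have h2 := hR n hn i
    omega
  let Z : Finset ℂ := (Finset.Ico 0 (N : ℤ)).image fun k => ζ ^ k
  have hzinj : Set.InjOn (fun k : ℤ => ζ ^ k) (Finset.Ico 0 (N : ℤ)) := fun a ha b hb hab => by
    simp only [Finset.coe_Ico, Set.mem_Ico] at ha hb
    lift a to ℕ using ha.1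
    lift b to ℕ using hb.1
    simp only [zpow_natCast] at hab
    exact_mod_cast hζ.pow_inj (by omega) (by omega) hab
  have hZ : #Z = N := by rw [Finset.card_image_of_injOn hzinj]; simp
  have heval : ∀ r : Fin d → ℤ, MvPolynomial.eval (fun i => ζ ^ r i) P
      = (∏ i, (ζ ^ r i) ^ (R : ℤ)) * ∑ n ∈ T, c n * torusChar n (gridPoint N r) := by
    intro r
    simp only [P, map_sum, MvPolynomial.eval_monomial, Finset.mul_sum]
    refine Finset.sum_congr rfl fun n hn => ?_
    rw [torusChar_gridPoint, mul_left_comm, ← Finset.prod_mul_distrib,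
      Finsupp.prod_fintype _ _ (by simp)]
    congr 1
    refine Finset.prod_congr rfl fun i _ => ?_
    rw [← zpow_natCast, hcast n hn i, ← zpow_add₀ (zpow_ne_zero _ hζ0), add_comm]
  have hcard : #{r ∈ latticeBox d N | ∑ n ∈ T, c n * torusChar n (gridPoint N r) = 0}
      ≤ #{x ∈ Fintype.piFinset fun _ : Fin d => Z | MvPolynomial.eval x P = 0} := by
    refine Finset.card_le_card_of_injOn (fun r i => ζ ^ r i) ?_ ?_
    · intro r hr
      simp only [Finset.coe_filter, Set.mem_ofPred_eq] at hr ⊢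
      refine ⟨Fintype.mem_piFinset.2 fun i => Finset.mem_image_of_mem _
        (Fintype.mem_piFinset.1 hr.1 i), ?_⟩
      rw [heval, hr.2, mul_zero]
    · intro r hr s hs h
      simp only [Finset.coe_filter, Set.mem_ofPred_eq] at hr hs
      funext i
      exact hzinj (Fintype.mem_piFinset.1 hr.1 i) (Fintype.mem_piFinset.1 hs.1 i)
        (congrFun h i)
  have hsz := MvPolynomial.schwartz_zippel_sum_degreeOf hP fun _ => Z
  simp only [hZ, Finset.prod_const, Finset.card_univ, Fintype.card_fin] at hsz
  have hsz' : (#{x ∈ Fintype.piFinset fun _ : Fin d => Z | MvPolynomial.eval x P = 0} : ℝ)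
      / (N : ℝ) ^ d ≤ ∑ i, (P.degreeOf i / N : ℝ) := by
    have := (NNRat.cast_le (K := ℝ)).2 hsz
    push_cast at this
    exact this
  calc _ ≤ (#{x ∈ Fintype.piFinset fun _ : Fin d => Z | MvPolynomial.eval x P = 0} : ℝ)
      / (N : ℝ) ^ d := by gcongr
    _ ≤ ∑ i, (P.degreeOf i / N : ℝ) := hsz'
    _ ≤ ∑ _i : Fin d, (2 * R / N : ℝ) := by
      refine Finset.sum_le_sum fun i _ => ?_
      gcongr
      exact_mod_cast hdeg i
    _ = 2 * R * d / N := by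
      rw [Finset.sum_const, Finset.card_univ, Fintype.card_fin, nsmul_eq_mul]
      ring

/-! ### The band function of a graph with one vertex per cell -/

namespace PeriodicGraph

/-- `H(p, q)` is the trigonometric polynomial whose frequencies are the `n` with
`v_q + n_𝔞 ∼ v_p`. -/
theorem floquetMatrix_apply {d : ℕ} {ι V : Type*} [DecidableEq ι] (Γ : PeriodicGraph d ι V)
    (θ : Fin d → ℝ) {p q : ι} {T : Finset (Fin d → ℤ)}
    (hT : ∀ n, n ∈ T ↔ Γ.graph.Adj (Γ.coord (p, 0)) (Γ.coord (q, n))) :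
    Γ.floquetMatrix θ p q = ∑ n ∈ T, torusChar n θ := by
  classical
  have hinj : Function.Injective fun n : Fin d → ℤ => Γ.coord (q, n) := fun a b h => by
    simpa using h
  have hsum : ∑ n ∈ T, torusChar n θ = ∑ v ∈ T.map ⟨_, hinj⟩,
      Γ.blochWave θ (Pi.single q 1) v := by
    rw [Finset.sum_map]
    exact Finset.sum_congr rfl fun n _ => by simp [blochWave, torusChar]
  rw [hsum, floquetMatrix, Matrix.of_apply, adjOp]
  refine (Finset.sum_subset (fun v hv => ?_) fun v hv hvT => ?_).symm
  · obtain ⟨n, hn, rfl⟩ := Finset.mem_map.1 hv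
    exact (Set.Finite.mem_toFinset _).2 ((hT n).1 hn)
  · obtain ⟨⟨i, n⟩, rfl⟩ := Γ.coord.surjective v
    have hi : i ≠ q := by
      rintro rfl
      exact hvT (Finset.mem_map.2 ⟨n, (hT n).2 ((Set.Finite.mem_toFinset _).1 hv), rfl⟩)
    simp [blochWave, hi]

/-- The set of those `n` with `v₀ + n_𝔞 ∼ v₀`, in a periodic graph with the single vertex `v₀` in
its fundamental domain. -/
noncomputable def hops {d : ℕ} {V : Type*} (Γ₀ : PeriodicGraph d Unit V) :
    Finset (Fin d → ℤ) :=
  ((Γ₀.locallyFinite (Γ₀.coord ((), 0))).preimage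
    (f := fun n : Fin d → ℤ => Γ₀.coord ((), n)) fun a _ b _ h => by simpa using h).toFinset

theorem mem_hops {d : ℕ} {V : Type*} (Γ₀ : PeriodicGraph d Unit V) (n : Fin d → ℤ) :
    n ∈ Γ₀.hops ↔ Γ₀.graph.Adj (Γ₀.coord ((), 0)) (Γ₀.coord ((), n)) := by
  simp [hops]

theorem zero_notMem_hops {d : ℕ} {V : Type*} (Γ₀ : PeriodicGraph d Unit V) :
    (0 : Fin d → ℤ) ∉ Γ₀.hops := by
  simp [mem_hops]

theorem band_eq_sum_hops {d : ℕ} {V : Type*} {Γ₀ : PeriodicGraph d Unit V}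
    {E₀ : (Fin d → ℝ) → ℝ} (hE₀ : Γ₀.IsBandFamily fun _ : Unit => E₀) (θ : Fin d → ℝ) :
    (E₀ θ : ℂ) = ∑ n ∈ Γ₀.hops, torusChar n θ := by
  have h := hE₀ θ
  rw [Matrix.charpoly, Matrix.det_unique] at h
  simp only [Matrix.charmatrix_apply_eq, Polynomial.roots_X_sub_C, PUnit.default_eq_unit] at h
  rw [← Γ₀.floquetMatrix_apply θ Γ₀.mem_hops]
  simpa using h.symm

/-- In a connected graph the hops generate `ℤ^d`: a character of `ℤ^d` that is trivial on the hops
is constant along the edges, hence trivial. -/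
theorem torusChar_eq_one_of_hops {d : ℕ} {V : Type*} {Γ₀ : PeriodicGraph d Unit V}
    (hconn : Γ₀.graph.Connected) {θ : Fin d → ℝ} (h : ∀ n ∈ Γ₀.hops, torusChar n θ = 1)
    (n : Fin d → ℤ) : torusChar n θ = 1 := by
  have hstep : ∀ u v : V, Γ₀.graph.Adj u v →
      torusChar (Γ₀.coord.symm u).2 θ = torusChar (Γ₀.coord.symm v).2 θ := by
    intro u v huv
    obtain ⟨⟨⟨⟩, a⟩, rfl⟩ := Γ₀.coord.surjective u
    obtain ⟨⟨⟨⟩, b⟩, rfl⟩ := Γ₀.coord.surjective v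
    have hab : b - a ∈ Γ₀.hops := by
      rw [mem_hops, ← Γ₀.periodic () () 0 (b - a) a]
      simpa using huv
    have hb : b = (b - a) + a := by simp
    simp only [Equiv.symm_apply_apply]
    rw [hb, torusChar_add_left, h _ hab, one_mul]
  have hreach : ∀ u v : V, Γ₀.graph.Reachable u v →
      torusChar (Γ₀.coord.symm u).2 θ = torusChar (Γ₀.coord.symm v).2 θ := by
    rintro u v ⟨p⟩
    induction p with
    | nil => rfl
    | cons hadj _ ih => exact (hstep _ _ hadj).trans ih
  have := hreach (Γ₀.coord ((), n)) (Γ₀.coord ((), 0)) (hconn.preconnected _ _)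
  simpa [torusChar_zero_left] using this

theorem exists_hop_torusChar_ne_one {d N : ℕ} {V : Type*} {Γ₀ : PeriodicGraph d Unit V}
    (hconn : Γ₀.graph.Connected) (hN : 0 < N) {m : Fin d → ℤ} (hm : m ∈ latticeBox d N)
    (hm0 : m ≠ 0) : ∃ n ∈ Γ₀.hops, torusChar n (gridPoint N m) ≠ 1 := by
  by_contra! h
  exact hm0 (funext fun i => torusChar_single_gridPoint_eq_one hN hm
    (torusChar_eq_one_of_hops hconn h _))

theorem hops_nonempty {d : ℕ} (hd : 0 < d) {V : Type*} {Γ₀ : PeriodicGraph d Unit V}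
    (hconn : Γ₀.graph.Connected) : Γ₀.hops.Nonempty := by
  -- `d > 0` provides a nonzero point of the box `{0, 1}^d`.
  obtain ⟨n, hn, -⟩ := exists_hop_torusChar_ne_one (N := 2) hconn two_pos
    (m := fun _ => 1) (by simp [latticeBox]) fun h => by simpa using congrFun h ⟨0, hd⟩
  exact ⟨n, hn⟩

/-- As `0` is not a hop, a constant can be added as the coefficient of the frequency `0` without
affecting the other coefficients. -/
theorem sum_insert_zero_hops {d : ℕ} {V : Type*} (Γ₀ : PeriodicGraph d Unit V)
    (c : (Fin d → ℤ) → ℂ) (b : ℂ) (θ : Fin d → ℝ) :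
    ∑ n ∈ insert 0 Γ₀.hops, (if n = 0 then b else c n) * torusChar n θ
      = b + ∑ n ∈ Γ₀.hops, c n * torusChar n θ := by
  rw [Finset.sum_insert Γ₀.zero_notMem_hops, if_pos rfl, torusChar_zero_left, mul_one]
  congr 1
  refine Finset.sum_congr rfl fun n hn => ?_
  have hn0 : n ≠ 0 := fun h => Γ₀.zero_notMem_hops (h ▸ hn)
  rw [if_neg hn0]

/-- The band function takes any given value on a negligible part of the grid. -/
theorem exists_card_band_eq_le {d : ℕ} (hd : 0 < d) {V : Type*} {Γ₀ : PeriodicGraph d Unit V}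
    (hconn : Γ₀.graph.Connected) {E₀ : (Fin d → ℝ) → ℝ}
    (hE₀ : Γ₀.IsBandFamily fun _ : Unit => E₀) :
    ∃ D : ℝ, ∀ N : ℕ, 0 < N → ∀ b : ℝ,
      (#{r ∈ latticeBox d N | E₀ (gridPoint N r) = b} : ℝ) / (N : ℝ) ^ d ≤ D / N := by
  obtain ⟨D, -, hD⟩ := exists_card_trigPoly_zeros_le (insert 0 Γ₀.hops)
  refine ⟨D, fun N hN b => ?_⟩
  obtain ⟨n, hn⟩ := hops_nonempty hd hconn
  have hn0 : n ≠ 0 := fun h => Γ₀.zero_notMem_hops (h ▸ hn)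
  refine le_trans (le_of_eq ?_) (hD N hN (fun n => if n = 0 then -(b : ℂ) else 1)
    ⟨n, Finset.mem_insert_of_mem hn, by simp [hn0]⟩)
  simp only [sum_insert_zero_hops, one_mul, ← band_eq_sum_hops hE₀]
  congr 3
  refine Finset.filter_congr fun r _ => ?_
  rw [neg_add_eq_zero, eq_comm, Complex.ofReal_inj]

/-- The difference of the band function and a translate of it takes any given value on a
negligible part of the grid, uniformly in the nonzero translation: the coefficient
`e^{2πi n·m/N} - 1` of the difference is nonzero for some hop `n`. -/
theorem exists_card_band_sub_eq_le {d : ℕ} {V : Type*} {Γ₀ : PeriodicGraph d Unit V}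
    (hconn : Γ₀.graph.Connected) {E₀ : (Fin d → ℝ) → ℝ}
    (hE₀ : Γ₀.IsBandFamily fun _ : Unit => E₀) :
    ∃ D : ℝ, 0 ≤ D ∧ ∀ N : ℕ, 0 < N → ∀ m ∈ latticeBox d N, m ≠ 0 → ∀ b : ℝ,
      (#{r ∈ latticeBox d N | E₀ (gridPoint N (r + m)) - E₀ (gridPoint N r) = b} : ℝ) /
        (N : ℝ) ^ d ≤ D / N := by
  obtain ⟨D, hD0, hD⟩ := exists_card_trigPoly_zeros_le (insert 0 Γ₀.hops)
  refine ⟨D, hD0, fun N hN m hm hm0 b => ?_⟩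
  obtain ⟨n, hn, hn1⟩ := exists_hop_torusChar_ne_one hconn hN hm hm0
  have hn0 : n ≠ 0 := fun h => Γ₀.zero_notMem_hops (h ▸ hn)
  refine le_trans (le_of_eq ?_) (hD N hN
    (fun n => if n = 0 then -(b : ℂ) else torusChar n (gridPoint N m) - 1)
    ⟨n, Finset.mem_insert_of_mem hn, by simpa [hn0, sub_eq_zero] using hn1⟩)
  simp only [sum_insert_zero_hops]
  congr 3
  refine Finset.filter_congr fun r _ => ?_
  have h : ∑ n ∈ Γ₀.hops, (torusChar n (gridPoint N m) - 1) * torusChar n (gridPoint N r)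
      = ((E₀ (gridPoint N (r + m)) - E₀ (gridPoint N r) : ℝ) : ℂ) := by
    rw [Complex.ofReal_sub, band_eq_sum_hops hE₀, band_eq_sum_hops hE₀, ← Finset.sum_sub_distrib]
    refine Finset.sum_congr rfl fun n _ => ?_
    rw [gridPoint_add, torusChar_add_right]
    ring
  rw [h, neg_add_eq_zero, eq_comm, Complex.ofReal_inj]

/-! ### The Floquet matrices of the products -/

section Products

variable {d : ℕ} {V F : Type*} [Fintype F] [DecidableEq F] {Γ₀ : PeriodicGraph d Unit V}
  {E₀ : (Fin d → ℝ) → ℝ} (G : SimpleGraph F) [DecidableRel G.Adj]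

theorem floquetMatrix_cartesian (hE₀ : Γ₀.IsBandFamily fun _ : Unit => E₀) (θ : Fin d → ℝ) :
    (Γ₀.cartesian G).floquetMatrix θ
      = (E₀ θ : ℂ) • (1 : Matrix F F ℂ) + ((1 : ℝ) : ℂ) • G.adjMatrix ℂ := by
  ext p q
  simp only [Matrix.add_apply, Matrix.smul_apply, Matrix.one_apply, SimpleGraph.adjMatrix_apply,
    smul_eq_mul, Complex.ofReal_one, band_eq_sum_hops hE₀]
  by_cases hpq : p = q
  · subst hpq
    rw [floquetMatrix_apply _ θ (T := Γ₀.hops)]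
    · simp
    · intro n
      simp [mem_hops, cartesian, prodCoord, SimpleGraph.boxProd_adj]
  · by_cases hadj : G.Adj p q
    · rw [floquetMatrix_apply _ θ (T := {0})]
      · simp [hpq, hadj, torusChar_zero_left]
      · intro n
        simp [cartesian, prodCoord, SimpleGraph.boxProd_adj, hpq, hadj, eq_comm]
    · rw [floquetMatrix_apply _ θ (T := ∅)]
      · simp [hpq, hadj]
      · intro n
        simp [cartesian, prodCoord, SimpleGraph.boxProd_adj, hpq, hadj]

theorem floquetMatrix_tensor (hE₀ : Γ₀.IsBandFamily fun _ : Unit => E₀) (θ : Fin d → ℝ) :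
    (Γ₀.tensor G).floquetMatrix θ
      = ((0 : ℝ) : ℂ) • (1 : Matrix F F ℂ) + (E₀ θ : ℂ) • G.adjMatrix ℂ := by
  ext p q
  simp only [Matrix.add_apply, Matrix.smul_apply, SimpleGraph.adjMatrix_apply,
    smul_eq_mul, Complex.ofReal_zero, band_eq_sum_hops hE₀]
  by_cases hadj : G.Adj p q
  · rw [floquetMatrix_apply _ θ (T := Γ₀.hops)]
    · simp [hadj]
    · intro n
      simp [mem_hops, tensor, tensorGraph, prodCoord, hadj]
  · rw [floquetMatrix_apply _ θ (T := ∅)]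
    · simp [hadj]
    · intro n
      simp [tensor, tensorGraph, prodCoord, hadj]

theorem floquetMatrix_strong (hE₀ : Γ₀.IsBandFamily fun _ : Unit => E₀) (θ : Fin d → ℝ) :
    (Γ₀.strong G).floquetMatrix θ
      = (E₀ θ : ℂ) • (1 : Matrix F F ℂ) + ((1 + E₀ θ : ℝ) : ℂ) • G.adjMatrix ℂ := by
  ext p q
  simp only [Matrix.add_apply, Matrix.smul_apply, Matrix.one_apply, SimpleGraph.adjMatrix_apply,
    smul_eq_mul, Complex.ofReal_add, Complex.ofReal_one,
    band_eq_sum_hops hE₀]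
  by_cases hpq : p = q
  · subst hpq
    rw [floquetMatrix_apply _ θ (T := Γ₀.hops)]
    · simp
    · intro n
      simp [mem_hops, strong, strongGraph, tensorGraph, prodCoord, SimpleGraph.boxProd_adj]
  · by_cases hadj : G.Adj p q
    · rw [floquetMatrix_apply _ θ (T := insert 0 Γ₀.hops)]
      · simp [hpq, hadj, torusChar_zero_left, Finset.sum_insert Γ₀.zero_notMem_hops]
      · intro n
        simp [mem_hops, strong, strongGraph, tensorGraph, prodCoord, SimpleGraph.boxProd_adj, hpq,
          hadj, eq_comm]
    · rw [floquetMatrix_apply _ θ (T := ∅)]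
      · simp [hpq, hadj]
      · intro n
        simp [strong, strongGraph, tensorGraph, prodCoord, SimpleGraph.boxProd_adj, hpq, hadj]

end Products

/-! ### Graphs whose Floquet matrices are affine functions of a fixed matrix -/

section Affine

variable {d : ℕ} {V F J : Type*} [Fintype F] [DecidableEq F] [Fintype J]
  {Γ : PeriodicGraph d F V} {A : Matrix F F ℂ} {α β : (Fin d → ℝ) → ℝ}
  (w : OrthonormalBasis J ℂ (EuclideanSpace ℂ F)) {μ : J → ℝ}

theorem isBandFamily_of_affine
    (hw : ∀ j, Matrix.toEuclideanLin A (w j) = (μ j : ℂ) • w j)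
    (hΓ : ∀ θ, Γ.floquetMatrix θ = (α θ : ℂ) • (1 : Matrix F F ℂ) + (β θ : ℂ) • A) :
    Γ.IsBandFamily fun j θ => α θ + β θ * μ j := fun θ => by
  rw [hΓ, charpoly_roots_of_eigenbasis w fun j => toEuclideanLin_affine_apply (hw j) _ _]
  simp

/-- The two averages differ only through the quasimomenta at which `β` vanishes, where the Floquet
matrix degenerates to the scalar matrix `α₀`. -/
theorem limitAverage_sub_finiteAverage_of_affine
    (hw : ∀ j, Matrix.toEuclideanLin A (w j) = (μ j : ℂ) • w j)
    (hΓ : ∀ θ, Γ.floquetMatrix θ = (α θ : ℂ) • (1 : Matrix F F ℂ) + (β θ : ℂ) • A)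
    {α₀ : ℝ} (hα : ∀ θ, β θ = 0 → α θ = α₀) {N : ℕ} (hN : 0 < N) (a : V → ℂ) (p : F) :
    Γ.limitAverage N a p - Γ.finiteAverage w μ N a p
      = ((#{r ∈ latticeBox d N | β (gridPoint N r) = 0} : ℝ) / (N : ℝ) ^ d : ℝ) *
        ∑ q, Γ.layerAverage N a q *
          ((eigenprojWeight ((α₀ : ℂ) • (1 : Matrix F F ℂ)) p q
            - ∑ z ∈ Finset.univ.image μ, ‖basisKernel w μ z p q‖ ^ 2 : ℝ) : ℂ) := by
  have hNd : (N : ℂ) ^ d ≠ 0 := pow_ne_zero _ (Nat.cast_ne_zero.2 hN.ne')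
  have hfin : Γ.finiteAverage w μ N a p = 1 / (N : ℂ) ^ d *
      ∑ _r ∈ latticeBox d N, Γ.finiteAverage w μ N a p := by
    rw [Finset.sum_const, card_latticeBox, nsmul_eq_mul]
    push_cast
    field_simp
  rw [hfin, limitAverage, ← mul_sub, ← Finset.sum_sub_distrib]
  have hterm : ∀ r ∈ latticeBox d N,
      (∑ q, Γ.layerAverage N a q *
        (eigenprojWeight (Γ.floquetMatrix (gridPoint N r)) p q : ℂ))
        - Γ.finiteAverage w μ N a p
      = if β (gridPoint N r) = 0 then ∑ q, Γ.layerAverage N a q *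
          ((eigenprojWeight ((α₀ : ℂ) • (1 : Matrix F F ℂ)) p q
            - ∑ z ∈ Finset.univ.image μ, ‖basisKernel w μ z p q‖ ^ 2 : ℝ) : ℂ) else 0 := by
    intro r _
    rw [finiteAverage, ← Finset.sum_sub_distrib]
    split_ifs with hβ
    · refine Finset.sum_congr rfl fun q _ => ?_
      rw [hΓ, hβ, hα _ hβ, Complex.ofReal_zero, zero_smul, add_zero, Complex.ofReal_sub, mul_sub]
    · refine Finset.sum_eq_zero fun q _ => ?_
      rw [hΓ, eigenprojWeight_of_eigenbasis w μ
        (g := fun x => (α (gridPoint N r) : ℂ) + β (gridPoint N r) * x) _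
        fun j => toEuclideanLin_affine_apply (hw j) _ _, sub_self]
      intro x y hxy
      simpa [hβ] using hxy
  rw [Finset.sum_congr rfl hterm, ← Finset.sum_filter, Finset.sum_const, nsmul_eq_mul]
  push_cast
  ring

theorem limitAverage_eq_finiteAverage_of_affine
    (hw : ∀ j, Matrix.toEuclideanLin A (w j) = (μ j : ℂ) • w j)
    (hΓ : ∀ θ, Γ.floquetMatrix θ = (α θ : ℂ) • (1 : Matrix F F ℂ) + (β θ : ℂ) • A)
    {α₀ : ℝ} (hα : ∀ θ, β θ = 0 → α θ = α₀) {N : ℕ} (hN : 0 < N)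
    (hβ : ∀ r ∈ latticeBox d N, β (gridPoint N r) ≠ 0) (a : V → ℂ) (p : F) :
    Γ.limitAverage N a p = Γ.finiteAverage w μ N a p := by
  rw [← sub_eq_zero, limitAverage_sub_finiteAverage_of_affine w hw hΓ hα hN,
    Finset.filter_false_of_mem hβ]
  simp

theorem asymptoticAverageFormula_of_affine
    (hw : ∀ j, Matrix.toEuclideanLin A (w j) = (μ j : ℂ) • w j)
    (hΓ : ∀ θ, Γ.floquetMatrix θ = (α θ : ℂ) • (1 : Matrix F F ℂ) + (β θ : ℂ) • A)
    {α₀ : ℝ} (hα : ∀ θ, β θ = 0 → α θ = α₀) {D : ℝ}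
    (hβ : ∀ N : ℕ, 0 < N →
      (#{r ∈ latticeBox d N | β (gridPoint N r) = 0} : ℝ) / (N : ℝ) ^ d ≤ D / N) :
    Γ.AsymptoticAverageFormula w μ := by
  intro a C hC p
  set W : F → ℝ := fun q => eigenprojWeight ((α₀ : ℂ) • (1 : Matrix F F ℂ)) p q
    - ∑ z ∈ Finset.univ.image μ, ‖basisKernel w μ z p q‖ ^ 2
  have hlim : Tendsto (fun N : ℕ => D / (N : ℝ) * ∑ q, C * |W q|) atTop (𝓝 0) := by
    simpa using (tendsto_const_div_atTop_nhds_zero_nat D).mul_const (∑ q, C * |W q|)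
  refine squeeze_zero_norm' ?_ hlim
  filter_upwards [eventually_gt_atTop 0] with N hN
  rw [limitAverage_sub_finiteAverage_of_affine w hw hΓ hα hN, norm_mul, Complex.norm_real,
    Real.norm_of_nonneg (by positivity)]
  refine mul_le_mul (hβ N hN) ((norm_sum_le _ _).trans (Finset.sum_le_sum fun q _ => ?_))
    (norm_nonneg _) (le_trans (by positivity) (hβ N hN))
  rw [norm_mul, Complex.norm_real, Real.norm_eq_abs]
  exact mul_le_mul_of_nonneg_right (hC N q) (abs_nonneg _)

end Affine

/-! ### The Floquet non-resonance assumption -/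

/-- A constant band violates the Floquet assumption: every `r` is resonant with every shift. -/
theorem not_floquetAssumption_of_flat_band {d : ℕ} (hd : 0 < d) {ι V : Type*} [Fintype ι]
    [DecidableEq ι] {Γ : PeriodicGraph d ι V} {E : ι → (Fin d → ℝ) → ℝ}
    (hE : Γ.IsBandFamily E) {s : ι} {c : ℝ} (hs : ∀ θ, E s θ = c) : ¬ Γ.FloquetAssumption := by
  intro h
  -- For `N ≥ 2` there is a nonzero shift `m`, so the supremum is at least `1`.
  have hone : (1 : ℝ) ≤ 0 := by
    refine le_of_tendsto_of_tendsto tendsto_const_nhds (h E hE s s) ?_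
    filter_upwards [eventually_ge_atTop 2] with N hN
    let m : {m : Fin d → ℤ // m ∈ latticeBox d N ∧ m ≠ 0} :=
      ⟨fun _ => 1, by simp [latticeBox]; omega, fun h => by simpa using congrFun h ⟨0, hd⟩⟩
    refine le_ciSup_of_le ⟨1, ?_⟩ m ?_
    · rintro _ ⟨m, rfl⟩
      exact card_filter_latticeBox_div_le_one _
    · simp only [hs, sub_self, Finset.filter_true, card_latticeBox, Nat.cast_pow]
      rw [div_self (by positivity)]
  exact absurd hone (by norm_num)

/-- For a graph whose bands are translates of one band function `E₀` by constants, a resonance is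
one of finitely many equations for `E₀(θ + m/N) - E₀(θ)`. -/
theorem floquetAssumption_of_translated_bands {d : ℕ} {V₀ : Type*}
    {Γ₀ : PeriodicGraph d Unit V₀} (hconn : Γ₀.graph.Connected) {E₀ : (Fin d → ℝ) → ℝ}
    (hE₀ : Γ₀.IsBandFamily fun _ : Unit => E₀) {ι V J : Type*} [Fintype ι] [DecidableEq ι]
    [Fintype J] {Γ : PeriodicGraph d ι V} {μ : J → ℝ}
    (hΓ : Γ.IsBandFamily fun j θ => E₀ θ + μ j) : Γ.FloquetAssumption := by
  classical
  intro E hE s t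
  obtain ⟨D, hD0, hD⟩ := exists_card_band_sub_eq_le hconn hE₀
  have hband : ∀ i θ, ∃ j, E i θ = E₀ θ + μ j := by
    intro i θ
    have hmem : (E i θ : ℂ) ∈ Finset.univ.val.map fun j => ((E₀ θ + μ j : ℝ) : ℂ) := by
      rw [← hΓ θ, hE θ]
      exact Multiset.mem_map_of_mem _ (Finset.mem_univ i)
    obtain ⟨j, -, hj⟩ := Multiset.mem_map.1 hmem
    exact ⟨j, (Complex.ofReal_injective hj).symm⟩
  set K : ℝ := (Fintype.card (J × J) : ℝ)
  have hlim : Tendsto (fun N : ℕ => K * D / (N : ℝ)) atTop (𝓝 0) :=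
    tendsto_const_div_atTop_nhds_zero_nat _
  refine squeeze_zero' (Eventually.of_forall fun N => Real.iSup_nonneg fun m => by positivity)
    ?_ hlim
  filter_upwards [eventually_gt_atTop 0] with N hN
  refine Real.iSup_le (fun m => ?_) (by positivity)
  have hsub : {r ∈ latticeBox d N | E s (gridPoint N (r + m.1)) - E t (gridPoint N r) = 0}
      ⊆ (Finset.univ : Finset (J × J)).biUnion fun jk =>
        {r ∈ latticeBox d N |
          E₀ (gridPoint N (r + m.1)) - E₀ (gridPoint N r) = μ jk.2 - μ jk.1} := by
    intro r hr
    obtain ⟨hr, h⟩ := Finset.mem_filter.1 hr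
    obtain ⟨j, hj⟩ := hband s (gridPoint N (r + m.1))
    obtain ⟨k, hk⟩ := hband t (gridPoint N r)
    refine Finset.mem_biUnion.2 ⟨(j, k), Finset.mem_univ _, Finset.mem_filter.2 ⟨hr, ?_⟩⟩
    rw [hj, hk] at h
    dsimp only
    linarith
  calc _ ≤ ((∑ jk : J × J, #{r ∈ latticeBox d N |
          E₀ (gridPoint N (r + m.1)) - E₀ (gridPoint N r) = μ jk.2 - μ jk.1} : ℕ) : ℝ)
          / (N : ℝ) ^ d := by
        gcongr
        exact (Finset.card_le_card hsub).trans Finset.card_biUnion_le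
    _ = ∑ jk : J × J, (#{r ∈ latticeBox d N |
          E₀ (gridPoint N (r + m.1)) - E₀ (gridPoint N r) = μ jk.2 - μ jk.1} : ℝ)
          / (N : ℝ) ^ d := by
        rw [Nat.cast_sum, Finset.sum_div]
    _ ≤ ∑ _jk : J × J, D / N :=
        Finset.sum_le_sum fun jk _ => hD N hN m.1 m.2.1 m.2.2 _
    _ = K * D / N := by
        rw [Finset.sum_const, Finset.card_univ, nsmul_eq_mul, mul_div_assoc]

/-- If an eigenvalue `μ` of the finite graph makes the band `α + β μ` constant, then the Floquet
assumption fails. -/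
theorem not_floquetAssumption_of_eigenvector {d : ℕ} (hd : 0 < d) {F V : Type*} [Fintype F]
    [DecidableEq F] {Γ : PeriodicGraph d F V} {A : Matrix F F ℂ} (hA : A.IsHermitian)
    {α β : (Fin d → ℝ) → ℝ}
    (hΓ : ∀ θ, Γ.floquetMatrix θ = (α θ : ℂ) • (1 : Matrix F F ℂ) + (β θ : ℂ) • A)
    {v : F → ℂ} (hv : v ≠ 0) {z c : ℝ} (hz : A.mulVec v = (z : ℂ) • v)
    (hc : ∀ θ, α θ + β θ * z = c) : ¬ Γ.FloquetAssumption := by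
  have hw : ∀ j, Matrix.toEuclideanLin A (hA.eigenvectorBasis j)
      = (hA.eigenvalues j : ℂ) • hA.eigenvectorBasis j := fun j => by
    ext i
    simpa using congrFun (hA.mulVec_eigenvectorBasis j) i
  obtain ⟨j, hj⟩ := exists_eigenbasis_index hA.eigenvectorBasis hw (v := WithLp.toLp 2 v)
    (z := z) (by simpa using hv) (by ext i; simp [hz])
  refine not_floquetAssumption_of_flat_band hd
    (isBandFamily_of_affine hA.eigenvectorBasis hw hΓ) (s := j) (c := c) fun θ => ?_
  rw [Complex.ofReal_inj.1 hj, hc]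

end PeriodicGraph

theorem proposition1p1 {d : ℕ} (hd : 0 < d) {V : Type*} (Γ₀ : PeriodicGraph d Unit V)
    (hconn : Γ₀.graph.Connected) (E₀ : (Fin d → ℝ) → ℝ)
    (hE₀ : Γ₀.IsBandFamily fun _ : Unit => E₀)
    {F : Type*} [Fintype F] [DecidableEq F] (G : SimpleGraph F) [DecidableRel G.Adj]
    {J : Type*} [Fintype J] (w : OrthonormalBasis J ℂ (EuclideanSpace ℂ F)) (μ : J → ℝ)
    (hw : ∀ j, Matrix.toEuclideanLin (G.adjMatrix ℂ) (w j) = (μ j : ℂ) • w j) :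
    -- the band functions of the three products
    (Γ₀.cartesian G).IsBandFamily (fun j θ => E₀ θ + μ j) ∧
    (Γ₀.tensor G).IsBandFamily (fun j θ => μ j * E₀ θ) ∧
    (Γ₀.strong G).IsBandFamily (fun j θ => (1 + μ j) * E₀ θ + μ j) ∧
    -- the Floquet assumption
    (Γ₀.cartesian G).FloquetAssumption ∧
    (∃ (n : ℕ) (G' : SimpleGraph (Fin n)), 2 ≤ n ∧ G'.Connected ∧
      ¬ (Γ₀.tensor G').FloquetAssumption) ∧
    (∃ (n : ℕ) (G' : SimpleGraph (Fin n)), 2 ≤ n ∧ G'.Connected ∧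
      ¬ (Γ₀.strong G').FloquetAssumption) ∧
    -- the kernels on the right-hand side are those of the eigenprojections of the finite graph
    (∀ (z : ℝ) (p q : F), basisKernel w μ z p q = eigenprojKernel (G.adjMatrix ℂ) z p q) ∧
    -- the limiting averages
    (∀ (N : ℕ), 0 < N → ∀ (a : V × F → ℂ) (p : F),
      (Γ₀.cartesian G).limitAverage N a p = (Γ₀.cartesian G).finiteAverage w μ N a p) ∧
    (∀ (N : ℕ), 0 < N → (∀ r ∈ latticeBox d N, E₀ (gridPoint N r) ≠ 0) →
      ∀ (a : V × F → ℂ) (p : F),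
        (Γ₀.tensor G).limitAverage N a p = (Γ₀.tensor G).finiteAverage w μ N a p) ∧
    (Γ₀.tensor G).AsymptoticAverageFormula w μ ∧
    (∀ (N : ℕ), 0 < N → (∀ r ∈ latticeBox d N, E₀ (gridPoint N r) ≠ -1) →
      ∀ (a : V × F → ℂ) (p : F),
        (Γ₀.strong G).limitAverage N a p = (Γ₀.strong G).finiteAverage w μ N a p) ∧
    (Γ₀.strong G).AsymptoticAverageFormula w μ := by
  classical
  have hcart := fun θ => Γ₀.floquetMatrix_cartesian G hE₀ θ
  have htens := fun θ => Γ₀.floquetMatrix_tensor G hE₀ θ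
  have hstr := fun θ => Γ₀.floquetMatrix_strong G hE₀ θ
  have hdegen : ∀ θ, 1 + E₀ θ = 0 → E₀ θ = -1 := fun θ h => by linarith
  have hbandC : (Γ₀.cartesian G).IsBandFamily (fun j θ => E₀ θ + μ j) := by
    simpa using PeriodicGraph.isBandFamily_of_affine w hw hcart
  obtain ⟨D, hD⟩ := PeriodicGraph.exists_card_band_eq_le hd hconn hE₀
  refine ⟨hbandC, ?_, ?_, PeriodicGraph.floquetAssumption_of_translated_bands hconn hE₀ hbandC,
    ?_, ?_, fun z p q => ?_, fun N hN => ?_, fun N hN h => ?_, ?_, fun N hN h => ?_, ?_⟩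
  · simpa [mul_comm] using PeriodicGraph.isBandFamily_of_affine w hw htens
  · have h := PeriodicGraph.isBandFamily_of_affine w hw hstr
    convert h using 3
    ring
  -- The path on three vertices has the eigenvalue `0`, which gives the flat band `0 * E₀`.
  · refine ⟨3, SimpleGraph.pathGraph 3, by norm_num, SimpleGraph.pathGraph_connected 2, ?_⟩
    refine PeriodicGraph.not_floquetAssumption_of_eigenvector hd
      (SimpleGraph.isHermitian_adjMatrix _ _)
      (fun θ => Γ₀.floquetMatrix_tensor _ hE₀ θ) (v := ![1, 0, -1]) (z := 0) (c := 0) ?_ ?_ ?_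
    · intro h
      simpa using congrFun h 0
    · ext i
      fin_cases i <;>
        simp [Matrix.mulVec, dotProduct, Fin.sum_univ_three, SimpleGraph.pathGraph_adj]
    · simp
  -- The single edge has the eigenvalue `-1`, which gives the flat band `(1 - 1) * E₀ - 1`.
  · refine ⟨2, ⊤, le_rfl, SimpleGraph.connected_top, ?_⟩
    refine PeriodicGraph.not_floquetAssumption_of_eigenvector hd
      (SimpleGraph.isHermitian_adjMatrix _ _)
      (fun θ => Γ₀.floquetMatrix_strong _ hE₀ θ) (v := ![1, -1]) (z := -1) (c := -1) ?_ ?_ ?_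
    · intro h
      simpa using congrFun h 0
    · ext i
      fin_cases i <;> simp [Matrix.mulVec, dotProduct, Fin.sum_univ_two]
    · intro θ
      ring
  · rw [eigenprojKernel_of_eigenbasis w hw, basisKernel]
    simp only [Complex.ofReal_inj]
  · exact PeriodicGraph.limitAverage_eq_finiteAverage_of_affine w hw hcart (α₀ := 0)
      (fun _ h => absurd h one_ne_zero) hN fun _ _ => one_ne_zero
  · exact PeriodicGraph.limitAverage_eq_finiteAverage_of_affine w hw htens (fun _ _ => rfl) hN h
  · exact PeriodicGraph.asymptoticAverageFormula_of_affine w hw htens (fun _ _ => rfl)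
      fun N hN => hD N hN 0
  · exact PeriodicGraph.limitAverage_eq_finiteAverage_of_affine w hw hstr hdegen hN
      fun r hr h0 => h r hr (hdegen _ h0)
  · refine PeriodicGraph.asymptoticAverageFormula_of_affine w hw hstr hdegen (D := D)
      fun N hN => ?_
    simpa only [add_comm (1 : ℝ), add_eq_zero_iff_eq_neg] using hD N hN (-1)
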